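/- **Model.** An edge-dynamic graph $\mathcal G$ on a node set $V$, with a static set $E$ of possible undirected edges and a bound $\Delta$, is a sequence of snapshots $G_t=(V,E_t)$, $E_t\subseteq E$, $t=0,1,2,\dots$, in which every node has at most $\Delta$ neighbours and which is otherwise arbitrary. A present edge $(u,v)$ is attached to a port of $u$ and a port of $v$, both in $\{0,\dots,\Delta-1\}$; different edges present at a node use different ports, and an edge keeps its ports while it is continuously present (a port may serve different edges at different times). Nodes are anonymous. When an edge present in stage $t-1$ is absent in stage $t$, at the beginning of stage $t$ its port labels are added to the sets $D$ of its endpoints; $D$ is reset to $\emptyset$ at the end of every activation of the node. **Synchronous executions.** An algorithm $\mathcal A_{sync}$ is a family of guarded actions, the same at all nodes. The state of a node consists of a main state and one state per port. The guards and operations of the actions refer to the state of the node and, for each port under consideration, to the neighbour's main state and the state of the neighbour's port of the connecting edge; the operations compute the new state of the node. A synchronous execution under $\mathcal G_{synch}=(H_0,H_1,\dots)$ starts from an arbitrary configuration; in step $i$ every node simultaneously runs one of its enabled actions, with respect to its neighbours in $H_i$ (a node without enabled action keeps its state). **The synchronizer $\kappa(\mathcal A_{sync})$.** Besides its $\mathcal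 A_{sync}$-state, every node has variables $\mathtt{synch}\in\{0,1\}$, $\mathtt{phase}\in\mathbb N$, flags $\ell.\mathtt{block},\ell.\mathtt{ack}\in\{0,1\}$ for every port $\ell$ (all initially $0$), sets of ports $I,P,D,\tilde D,F$ (initially empty), and for every port the information $X(\ell)$ last pulled through $\ell$. Pulling through $\ell$ returns all main variables of the neighbour (everything except its port states and stored pulled information), together with the state, the label $\mathtt{port}$ and the flags of the neighbour's port of the connecting edge. Let $N$ be the set of ports of the node that carry an edge in the current stage. A node has two actions. * *Handshake*, enabled if $\mathtt{synch}=0$ or $\ell.\mathtt{block}=0$ for some $\ell\in P\setminus\tilde D$. If $\mathtt{synch}=0$: pull $X(\ell)$ for all $\ell\in N$; set $\tilde D:=\emptyset$; let $I$ be the set of $\ell\in N$ such that either $X(\ell).\mathtt{phase}>\mathtt{phase}$, or $X(\ell).\mathtt{phase}=\mathtt{phase}$, $X(\ell).\mathtt{synch}=1$ and ($X(\ell).\mathtt{port}\notin X(\ell).P$ or $X(\ell).\mathtt{port}\in X(\ell).\tilde D\cup X(\ell).D$); set $P:=N\setminus I$ and $\mathtt{synch}:=1$. If $\mathtt{synch}=1$: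 for every $\ell\in P\setminus(\tilde D\cup D)$ pull $X(\ell)$ anew if $X(\ell).\mathtt{phase}<\mathtt{phase}$, and otherwise update only $X(\ell).\mathtt{ack}$; then set $\tilde D:=\tilde D\cup D$. In both cases, then, for every $\ell\in P\setminus\tilde D$ with $X(\ell).\mathtt{phase}=\mathtt{phase}$ and $\ell.\mathtt{block}=0$: if $X(\ell).\mathtt{ack}=1$, set to $1$ both $\ell.\mathtt{block}$ and the $\mathtt{block}$ flag of the neighbour's port of the connecting edge; otherwise set $\ell.\mathtt{ack}:=1$. * *ExecuteSynch*, enabled if $\mathtt{synch}=1$ and $\ell.\mathtt{block}=1$ for all $\ell\in P\setminus\tilde D$. Set $F:=\{\ell\in P: \ell.\mathtt{block}=1\}$, run an enabled action of $\mathcal A_{sync}$ with respect to $\{X(\ell):\ell\in F\}$ (if none is enabled, the $\mathcal A_{sync}$-state is unchanged), increase $\mathtt{phase}$ by $1$, and set $\mathtt{synch}$ and all $\mathtt{ack}$ and $\mathtt{block}$ flags to $0$. In a semi-synchronous execution under $\mathcal G_{semi}=(G_0,G_1,\dots)$, in every stage $t$ the scheduler activates an arbitrary set of enabled nodes, each of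 which executes one enabled action in the graph $G_t$. All active nodes read the configuration at the start of the stage (after the disconnections have been detected), their writes take effect within the stage, and a neighbour's write of $1$ to a $\mathtt{block}$ flag always succeeds. The execution is weakly fair if every continuously enabled node is eventually activated. Phase $i$ of a node ends with the stage in which its variable $\mathtt{phase}$ changes from $i$ to $i+1$. **Theorem (Correctness).** For every algorithm $\mathcal A_{sync}$, every edge-dynamic graph $\mathcal G_{synch}$ and every synchronous execution of $\mathcal A_{sync}$ under $\mathcal G_{synch}$, there exist an edge-dynamic graph $\mathcal G_{semi}$ (with the same $V$, $E$ and $\Delta$) and a weakly-fair semi-synchronous execution of $\kappa(\mathcal A_{sync})$ under $\mathcal G_{semi}$, starting from the same $\mathcal A_{sync}$-states, such that for every $i\ge 0$ every node ends its phase $i$ in some stage, and its $\mathcal A_{sync}$-state at the end of phase $i$ equals its state at the end of step $i$ of the synchronous execution. -/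

import Mathlib

namespace KappaSync

/-! ## Dynamic networks with port labels -/

/-- A time-varying graph with node set `V`, static edge set `E`, at most `Δ` neighbours per node and
stages `0, 1, 2, …`.  `snap t` is the snapshot `G_t`, so that an edge `e` is present at time `t`
iff `e` is an edge of `snap t`; the edges of the snapshots are otherwise arbitrary.  Every present
edge is attached to one port at each of its two endpoints; distinct edges at a node use distinct
ports (hence the degree bound `Δ`), and an edge keeps its ports for as long as it is continuously
present.  A port may serve different edges at different times. -/
structure TVGraph {V : Type*} (E : SimpleGraph V) (Δ : ℕ) where
  snap : ℕ → SimpleGraph V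
  snap_le : ∀ t, snap t ≤ E
  port : ∀ (t : ℕ) (u v : V), (snap t).Adj u v → Fin Δ
  port_inj : ∀ (t : ℕ) (u v w : V) (hv : (snap t).Adj u v) (hw : (snap t).Adj u w),
    port t u v hv = port t u w hw → v = w
  port_persist : ∀ (t : ℕ) (u v : V) (h : (snap t).Adj u v) (h' : (snap (t + 1)).Adj u v),
    port t u v h = port (t + 1) u v h'

namespace TVGraph

variable {V : Type*} {E : SimpleGraph V} {Δ : ℕ}

open Classical in
/-- What port `ℓ` of `u` is attached to in stage `t`: `some (v, m)` if it carries the edge `(u, v)`,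
whose port at `v` is `m`, and `none` if the port carries no edge. -/
noncomputable def peer (G : TVGraph E Δ) (t : ℕ) (u : V) (ℓ : Fin Δ) : Option (V × Fin Δ) :=
  if h : ∃ v, ∃ e : (G.snap t).Adj u v, G.port t u v e = ℓ then
    some (h.choose, G.port t h.choose u h.choose_spec.choose.symm)
  else none

theorem peer_eq_some_iff (G : TVGraph E Δ) (t : ℕ) (u v : V) (ℓ m : Fin Δ) :
    G.peer t u ℓ = some (v, m) ↔
      ∃ e : (G.snap t).Adj u v, G.port t u v e = ℓ ∧ G.port t v u e.symm = m := by
  unfold peer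
  split_ifs with h
  · have hs := h.choose_spec
    constructor
    · intro heq
      simp only [Option.some.injEq, Prod.mk.injEq] at heq
      obtain ⟨h1, h2⟩ := heq
      subst h1
      exact ⟨hs.choose, hs.choose_spec, h2⟩
    · rintro ⟨e, h1, h2⟩
      have hv : h.choose = v :=
        G.port_inj t u _ _ hs.choose e (hs.choose_spec.trans h1.symm)
      subst hv
      rw [h2]
  · constructor
    · intro heq
      cases heq
    · rintro ⟨e, h1, -⟩
      exact absurd ⟨v, e, h1⟩ h

/-- The ports of `u` that are disconnected by the topology change at the beginning of stage `t`. -/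
def lost (G : TVGraph E Δ) : ℕ → V → Set (Fin Δ)
  | 0, _ => ∅
  | t + 1, u => {ℓ | ∃ v, ∃ e : (G.snap t).Adj u v,
      G.port t u v e = ℓ ∧ ¬ (G.snap (t + 1)).Adj u v}

end TVGraph

/-! ## Synchronous algorithms -/

/-- The memory of a node under the simulated algorithm: the main state and one state per port. -/
structure AlgState (Δ : ℕ) (M Q : Type*) where
  main : M
  ports : Fin Δ → Q

/-- What the algorithm sees of the neighbours: for each port under consideration, the main state of
the neighbour attached to it and the state of the neighbour's port of the connecting edge;
`none` for the other ports. -/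
abbrev View (Δ : ℕ) (M Q : Type*) := Fin Δ → Option (M × Q)

/-- An anonymous algorithm for the Pull model, as a family of guarded actions `guard → operations`.
All nodes run the same actions. -/
structure Alg (Δ : ℕ) (M Q Act : Type*) where
  guard : Act → AlgState Δ M Q → View Δ M Q → Prop
  op : Act → AlgState Δ M Q → View Δ M Q → AlgState Δ M Q

section Sync

variable {V : Type*} {E : SimpleGraph V} {Δ : ℕ} {M Q Act : Type*}

/-- A node in state `s` with view `w` runs one enabled action and gets to state `s'`; if no action is
enabled, the state does not change. -/
def Alg.Run (A : Alg Δ M Q Act) (s : AlgState Δ M Q) (w : View Δ M Q) (s' : AlgState Δ M Q) : Prop :=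
  (∃ a, A.guard a s w ∧ s' = A.op a s w) ∨ ((∀ a, ¬ A.guard a s w) ∧ s' = s)

/-- The information that `u` pulls from its neighbours in the synchronous step `i`. -/
noncomputable def syncView (G : TVGraph E Δ) (i : ℕ) (x : V → AlgState Δ M Q) (u : V) :
    View Δ M Q :=
  fun ℓ => (G.peer i u ℓ).map fun p => ((x p.1).main, (x p.1).ports p.2)

/-- `x` is a synchronous execution of `A` under `G`: `x 0` is the (arbitrary) initial configuration,
and `x (i + 1)` is the configuration at the end of step `i`, in which all nodes are active. -/
def IsSyncExecution (A : Alg Δ M Q Act) (G : TVGraph E Δ) (x : ℕ → V → AlgState Δ M Q) : Prop :=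
  ∀ i u, A.Run (x i u) (syncView G i (x i) u) (x (i + 1) u)

end Sync

/-! ## The synchronizer -/

/-- What a node obtains by pulling through a port: all main variables of the neighbour and the
variables of the neighbour's port of the connecting edge. -/
structure Pulled (Δ : ℕ) (M Q : Type*) where
  synch : Bool
  phase : ℕ
  I : Set (Fin Δ)
  P : Set (Fin Δ)
  D : Set (Fin Δ)
  Dt : Set (Fin Δ)
  F : Set (Fin Δ)
  block : Bool
  ack : Bool
  port : Fin Δ
  main : M
  portState : Q

/-- The memory of a node under the synchronizer.  `alg` is the state of the simulated algorithm,
`Dt` is the set of ports disconnected during the current phase, and `X ℓ` is the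
information last pulled through port `ℓ` (`none` if there is none). -/
structure KState (Δ : ℕ) (M Q : Type*) where
  alg : AlgState Δ M Q
  synch : Bool
  phase : ℕ
  block : Fin Δ → Bool
  ack : Fin Δ → Bool
  I : Set (Fin Δ)
  P : Set (Fin Δ)
  D : Set (Fin Δ)
  Dt : Set (Fin Δ)
  F : Set (Fin Δ)
  X : Fin Δ → Option (Pulled Δ M Q)

/-- The two actions of the synchronizer. -/
inductive KAction
  | handshake
  | executeSynch

namespace KState

variable {Δ : ℕ} {M Q Act : Type*}

/-- The initial state of the synchronizer, when the simulated algorithm starts from `s`. -/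
def init (s : AlgState Δ M Q) : KState Δ M Q where
  alg := s
  synch := false
  phase := 0
  block := fun _ => false
  ack := fun _ => false
  I := ∅
  P := ∅
  D := ∅
  Dt := ∅
  F := ∅
  X := fun _ => none

/-- The variables of a node that can be pulled by the neighbour attached to its port `m`. -/
def exposed (s : KState Δ M Q) (m : Fin Δ) : Pulled Δ M Q where
  synch := s.synch
  phase := s.phase
  I := s.I
  P := s.P
  D := s.D
  Dt := s.Dt
  F := s.F
  block := s.block m
  ack := s.ack m
  port := m
  main := s.alg.main
  portState := s.alg.ports m

/-- The guards of the two actions. -/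
def guard (s : KState Δ M Q) : KAction → Prop
  | .handshake => s.synch = false ∨ ∃ ℓ ∈ s.P \ s.Dt, s.block ℓ = false
  | .executeSynch => s.synch = true ∧ ∀ ℓ ∈ s.P \ s.Dt, s.block ℓ = true

/-- A node is enabled if one of its actions is. -/
def Enabled (s : KState Δ M Q) : Prop := ∃ a, s.guard a

/-- The ports leading to invalid neighbours, where `r ℓ` is the information available through port
`ℓ` (`none` if the port carries no edge). -/
def invalid (s : KState Δ M Q) (r : Fin Δ → Option (Pulled Δ M Q)) : Set (Fin Δ) :=
  {ℓ | ∃ x, r ℓ = some x ∧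
    ((x.phase = s.phase ∧ x.synch = true ∧ (x.port ∉ x.P ∨ x.port ∈ x.Dt ∪ x.D)) ∨
      s.phase < x.phase)}

open Classical in
/-- First part of a handshake: if `synch = 0`, pull from all current neighbours and set up the phase;
otherwise pull again from the neighbours at valid persistent ports (the full information if the
neighbour was seen in a lower phase, only its `ack` otherwise), and record the disconnections. -/
noncomputable def refresh (s : KState Δ M Q) (r : Fin Δ → Option (Pulled Δ M Q)) : KState Δ M Q :=
  if s.synch = false then
    { s with
      X := fun ℓ => (r ℓ).or (s.X ℓ)
      Dt := ∅
      I := s.invalid r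
      P := {ℓ | (r ℓ).isSome} \ s.invalid r
      synch := true }
  else
    { s with
      X := fun ℓ =>
        if ℓ ∈ s.P \ (s.Dt ∪ s.D) then
          match s.X ℓ, r ℓ with
          | some x, some y => if x.phase < s.phase then some y else some { x with ack := y.ack }
          | o, _ => o
        else s.X ℓ
      Dt := s.Dt ∪ s.D }

/-- The ports dealt with in the second part of a handshake, with the value `b` of the pulled
acknowledgment flag. -/
def pending (s : KState Δ M Q) (b : Bool) : Set (Fin Δ) :=
  {ℓ | ℓ ∈ s.P \ s.Dt ∧ s.block ℓ = false ∧ ∃ x, s.X ℓ = some x ∧ x.phase = s.phase ∧ x.ack = b}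

open Classical in
/-- The local effect of a handshake: at each pending port the `block` flag is set if the neighbour
has acknowledged, and the `ack` flag otherwise. -/
noncomputable def handshake (s : KState Δ M Q) (r : Fin Δ → Option (Pulled Δ M Q)) : KState Δ M Q :=
  { s.refresh r with
    block := fun ℓ => if ℓ ∈ (s.refresh r).pending true then true else s.block ℓ
    ack := fun ℓ => if ℓ ∈ (s.refresh r).pending false then true else s.ack ℓ }

/-- The ports through which a node performing a handshake sets the neighbour's `block` flag to 1. -/
def blockedPorts (s : KState Δ M Q) (r : Fin Δ → Option (Pulled Δ M Q)) : Set (Fin Δ) :=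
  (s.refresh r).pending true

/-- The set `F` that is computed at the start of `ExecuteSynch`. -/
def final (s : KState Δ M Q) : Set (Fin Δ) := {ℓ | ℓ ∈ s.P ∧ s.block ℓ = true}

open Classical in
/-- The stored neighbour information with respect to which the simulated action is run. -/
noncomputable def view (s : KState Δ M Q) : View Δ M Q :=
  fun ℓ => if ℓ ∈ s.final then (s.X ℓ).map fun x => (x.main, x.portState) else none

/-- The local effect of `ExecuteSynch`, if the simulated action leads to the state `a`. -/
def execute (s : KState Δ M Q) (a : AlgState Δ M Q) : KState Δ M Q :=
  { s with
    F := s.final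
    alg := a
    phase := s.phase + 1
    synch := false
    ack := fun _ => false
    block := fun _ => false }

/-- `s'` is a possible result of the local effect of an action in state `s`. -/
def Effect (A : Alg Δ M Q Act) (s : KState Δ M Q) (r : Fin Δ → Option (Pulled Δ M Q))
    (s' : KState Δ M Q) : KAction → Prop
  | .handshake => s' = s.handshake r
  | .executeSynch => ∃ a, A.Run s.alg s.view a ∧ s' = s.execute a

end KState

/-! ## Semi-synchronous executions of the synchronizer -/

section Semi

variable {V : Type*} {E : SimpleGraph V} {Δ : ℕ} {M Q Act : Type*}

/-- The disconnection detectors act at the beginning of stage `t`. -/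
def detect (G : TVGraph E Δ) (t : ℕ) (C : V → KState Δ M Q) : V → KState Δ M Q :=
  fun u => { C u with D := (C u).D ∪ G.lost t u }

/-- What `u` can pull through its ports in stage `t`. -/
noncomputable def pull (G : TVGraph E Δ) (t : ℕ) (C : V → KState Δ M Q) (u : V) :
    Fin Δ → Option (Pulled Δ M Q) :=
  fun ℓ => (G.peer t u ℓ).map fun p => (C p.1).exposed p.2

/-- In stage `t`, with the nodes acting as told by `act`, some neighbour of `u` writes the value 1 to
the multi-writer register `block` of port `ℓ` of `u`. -/
def WritesBlock (G : TVGraph E Δ) (t : ℕ) (act : V → Option KAction) (C : V → KState Δ M Q)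
    (u : V) (ℓ : Fin Δ) : Prop :=
  ∃ v m, G.peer t u ℓ = some (v, m) ∧ act v = some .handshake ∧
    m ∈ (C v).blockedPorts (pull G t C v)

/-- Local outcome `s'` for node `u`: nothing happens to an inactive node; an active node executes the
chosen action, which has to be enabled, and then resets its disconnection detector. -/
def LocalOutcome (A : Alg Δ M Q Act) (G : TVGraph E Δ) (t : ℕ) (C : V → KState Δ M Q) (u : V)
    (s' : KState Δ M Q) : Option KAction → Prop
  | none => s' = C u
  | some a => (C u).guard a ∧
      ∃ s, KState.Effect A (C u) (pull G t C u) s a ∧ s' = { s with D := ∅ }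

open Classical in
/-- Stage `t` leads from the configuration `C` to `C'`.  All active nodes read the configuration at
the start of the stage (after the disconnections of this stage have been detected); their writes
take effect together, a neighbour's write of 1 to a `block` register always succeeding. -/
def IsStage (A : Alg Δ M Q Act) (G : TVGraph E Δ) (t : ℕ) (act : V → Option KAction)
    (C C' : V → KState Δ M Q) : Prop :=
  ∃ L : V → KState Δ M Q,
    (∀ u, LocalOutcome A G t (detect G t C) u (L u) (act u)) ∧
    ∀ u, C' u = { L u with
      block := fun ℓ => if WritesBlock G t act (detect G t C) u ℓ then true else (L u).block ℓ }

/-- A semi-synchronous execution of the synchronizer applied to `A`, under `G`: `C t` is the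
configuration at the start of stage `t`, `act t u = some a` says that the scheduler activates `u` in
stage `t` with action `a`, and `act t u = none` that `u` is not activated. -/
structure IsSemiSyncExecution (A : Alg Δ M Q Act) (G : TVGraph E Δ)
    (act : ℕ → V → Option KAction) (C : ℕ → V → KState Δ M Q) : Prop where
  init : ∀ u, ∃ s, C 0 u = KState.init s
  stage : ∀ t, IsStage A G t (act t) (C t) (C (t + 1))

/-- Weak fairness: every continuously enabled node is eventually activated. -/
def WeaklyFair (act : ℕ → V → Option KAction) (C : ℕ → V → KState Δ M Q) : Prop :=
  ∀ u t, (∀ s, t ≤ s → (C s u).Enabled) → ∃ s, t ≤ s ∧ act s u ≠ none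

/-- Stage `t` is the last stage of phase `i` of node `u`. -/
def EndsPhase (C : ℕ → V → KState Δ M Q) (u : V) (i t : ℕ) : Prop :=
  (C t u).phase = i ∧ (C (t + 1) u).phase = i + 1

end Semi

end KappaSync

/-!
The semi-synchronous execution replays every synchronous step in three stages, during which the
topology is held fixed: stages `3 i`, `3 i + 1` and `3 i + 2` all use the snapshot of step `i`.  The
nodes move in lockstep.

* In stage `3 i` all nodes perform a handshake.  They are all in phase `i` with `synch = 0`, so no
  neighbour is invalid: every node pulls the main and port states of all its neighbours, takes `P`
  to be the set of all its connected ports, and raises `ack` on them.  Whatever was disconnected by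
  the change of topology at the beginning of the stage is forgotten when `D` is reset.
* In stage `3 i + 1` all nodes that still have an unblocked port in `P` perform a second handshake,
  in which they read `ack = 1` everywhere and therefore set `block` on every port in `P`.  Isolated
  nodes have no enabled handshake and stay inactive.
* In stage `3 i + 2` all nodes perform `ExecuteSynch`.  Now `F = P` is the set of all connected ports,
  and the stored information is what was pulled in stage `3 i`, when the neighbours were still
  in the states of step `i`; hence the view is exactly the view of the synchronous step `i`, and the
  synchronous algorithm can make the very choice it makes in the given execution.

The lemmas `AtStart.next`, `Acknowledged.next` and `Blocked.next` establish these three points.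
-/

namespace KappaSync

variable {V : Type*} {E : SimpleGraph V} {Δ : ℕ} {M Q Act : Type*}

/-! ### Slowing down a dynamic graph -/

/-- The dynamic graph whose stage `t` shows the snapshot `f t` of `G`, where `f` either
stays or advances by one in every stage, so that persistent edges keep their ports. -/
def TVGraph.slowDown (G : TVGraph E Δ) (f : ℕ → ℕ)
    (hf : ∀ t, f (t + 1) = f t ∨ f (t + 1) = f t + 1) : TVGraph E Δ where
  snap t := G.snap (f t)
  snap_le t := G.snap_le (f t)
  port t := G.port (f t)
  port_inj t := G.port_inj (f t)
  port_persist t u v h h' := by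
    have key : ∀ n, n = f t ∨ n = f t + 1 → ∀ h' : (G.snap n).Adj u v,
        G.port (f t) u v h = G.port n u v h' := by
      rintro n (rfl | rfl) h'
      · rfl
      · exact G.port_persist _ _ _ h h'
    exact key _ (hf t) h'

theorem TVGraph.peer_slowDown (G : TVGraph E Δ) (f : ℕ → ℕ)
    (hf : ∀ t, f (t + 1) = f t ∨ f (t + 1) = f t + 1) (t : ℕ) (u : V) (ℓ : Fin Δ) :
    (G.slowDown f hf).peer t u ℓ = G.peer (f t) u ℓ := rfl

theorem TVGraph.lost_eq_empty_of_snap_eq (G : TVGraph E Δ) (t : ℕ) (u : V)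
    (h : G.snap t = G.snap (t + 1)) : G.lost (t + 1) u = ∅ := by
  ext ℓ
  simp only [TVGraph.lost, Set.mem_ofPred_eq, Set.mem_empty_iff_false, iff_false]
  rintro ⟨v, e, -, hne⟩
  exact hne (h ▸ e)

theorem TVGraph.peer_symm (G : TVGraph E Δ) {t : ℕ} {u v : V} {ℓ m : Fin Δ}
    (h : G.peer t u ℓ = some (v, m)) : G.peer t v m = some (u, ℓ) := by
  rw [TVGraph.peer_eq_some_iff] at h ⊢
  obtain ⟨e, h1, h2⟩ := h
  exact ⟨e.symm, h2, h1⟩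

/-! ### Running a stage -/

/-- The local effect of the scheduled action on a node, where `a` is the state to which the
simulated algorithm moves in case of `ExecuteSynch`. -/
noncomputable def localNext (s : KState Δ M Q) (r : Fin Δ → Option (Pulled Δ M Q))
    (a : AlgState Δ M Q) : Option KAction → KState Δ M Q
  | none => s
  | some .handshake => { s.handshake r with D := ∅ }
  | some .executeSynch => { s.execute a with D := ∅ }

open Classical in
/-- The configuration after stage `t`, started in `C`, where `y u` is the state to which the simulated
algorithm moves at `u` if `u` performs `ExecuteSynch`. -/
noncomputable def nextConfig (G : TVGraph E Δ) (t : ℕ) (act : V → Option KAction)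
    (y : V → AlgState Δ M Q) (C : V → KState Δ M Q) (u : V) : KState Δ M Q :=
  { localNext (detect G t C u) (pull G t (detect G t C) u) (y u) (act u) with
    block := fun ℓ => if WritesBlock G t act (detect G t C) u ℓ then true else
      (localNext (detect G t C u) (pull G t (detect G t C) u) (y u) (act u)).block ℓ }

theorem isStage_nextConfig (A : Alg Δ M Q Act) (G : TVGraph E Δ) (t : ℕ)
    (act : V → Option KAction) (y : V → AlgState Δ M Q) (C : V → KState Δ M Q)
    (hguard : ∀ u a, act u = some a → (detect G t C u).guard a)
    (hrun : ∀ u, act u = some .executeSynch →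
      A.Run (detect G t C u).alg (detect G t C u).view (y u)) :
    IsStage A G t act C (nextConfig G t act y C) := by
  refine ⟨fun u => localNext (detect G t C u) (pull G t (detect G t C) u) (y u) (act u),
    fun u => ?_, fun u => rfl⟩
  dsimp only
  rcases hu : act u with _ | _ | _
  · rfl
  · exact ⟨hguard u _ hu, _, rfl, rfl⟩
  · exact ⟨hguard u _ hu, _, ⟨y u, hrun u hu, rfl⟩, rfl⟩

/-! ### The three stages of a synchronous step -/

/-- All nodes are at the beginning of phase `i`, with the simulated algorithm in configuration `y`. -/
structure AtStart (i : ℕ) (y : V → AlgState Δ M Q) (C : V → KState Δ M Q) : Prop where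
  alg : ∀ u, (C u).alg = y u
  synch : ∀ u, (C u).synch = false
  phase : ∀ u, (C u).phase = i
  block : ∀ u ℓ, (C u).block ℓ = false
  ack : ∀ u ℓ, (C u).ack ℓ = false

/-- What holds during phase `i` after its first handshakes, in stages with the topology given by
`peer`: the valid persistent ports are the connected ones, and the stored information is what
the neighbours showed at the beginning of the phase. -/
structure Connected (peer : V → Fin Δ → Option (V × Fin Δ)) (i : ℕ) (y : V → AlgState Δ M Q)
    (C : V → KState Δ M Q) : Prop where
  alg : ∀ u, (C u).alg = y u
  synch : ∀ u, (C u).synch = true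
  phase : ∀ u, (C u).phase = i
  P : ∀ u, (C u).P = {ℓ | (peer u ℓ).isSome}
  Dt : ∀ u, (C u).Dt = ∅
  D : ∀ u, (C u).D = ∅
  X : ∀ u ℓ v m, peer u ℓ = some (v, m) → ∃ z, (C u).X ℓ = some z ∧ z.phase = i ∧
    z.main = (y v).main ∧ z.portState = (y v).ports m

/-- After the first handshakes of phase `i`, every node has acknowledged at all connected ports. -/
structure Acknowledged (peer : V → Fin Δ → Option (V × Fin Δ)) (i : ℕ) (y : V → AlgState Δ M Q)
    (C : V → KState Δ M Q) : Prop extends Connected peer i y C where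
  ack : ∀ u ℓ, (peer u ℓ).isSome → (C u).ack ℓ = true

/-- After the second handshakes of phase `i`, all connected ports are blocked. -/
structure Blocked (peer : V → Fin Δ → Option (V × Fin Δ)) (i : ℕ) (y : V → AlgState Δ M Q)
    (C : V → KState Δ M Q) : Prop extends Connected peer i y C where
  block : ∀ u ℓ, (peer u ℓ).isSome → (C u).block ℓ = true

theorem AtStart.detect {i : ℕ} {y : V → AlgState Δ M Q} {C : V → KState Δ M Q}
    (h : AtStart i y C) (G : TVGraph E Δ) (t : ℕ) : AtStart i y (detect G t C) :=
  ⟨h.alg, h.synch, h.phase, h.block, h.ack⟩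

theorem detect_eq_self {G : TVGraph E Δ} {t : ℕ} (hlost : ∀ u, G.lost t u = ∅)
    (C : V → KState Δ M Q) : detect G t C = C := by
  funext u
  simp [detect, hlost]

/-- With all nodes at the beginning of the same phase, no neighbour is invalid. -/
theorem AtStart.invalid_eq_empty {i : ℕ} {y : V → AlgState Δ M Q} {C : V → KState Δ M Q}
    (h : AtStart i y C) (G : TVGraph E Δ) (t : ℕ) (u : V) :
    (C u).invalid (pull G t C u) = ∅ := by
  ext ℓ
  simp only [KState.invalid, pull, Set.mem_ofPred_eq, Set.mem_empty_iff_false, iff_false]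
  rintro ⟨z, hz, hz'⟩
  obtain ⟨⟨v, m⟩, -, rfl⟩ := Option.map_eq_some_iff.1 hz
  simp [KState.exposed, h.synch, h.phase] at hz'

theorem AtStart.refresh_eq {i : ℕ} {y : V → AlgState Δ M Q} {C : V → KState Δ M Q}
    (h : AtStart i y C) (G : TVGraph E Δ) (t : ℕ) (u : V) :
    (C u).refresh (pull G t C u) =
      { C u with
        X := fun ℓ => (pull G t C u ℓ).or ((C u).X ℓ)
        Dt := ∅
        I := ∅
        P := {ℓ | (G.peer t u ℓ).isSome}
        synch := true } := by
  simp [KState.refresh, h.synch u, h.invalid_eq_empty, pull]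

theorem AtStart.mem_pending_false {i : ℕ} {y : V → AlgState Δ M Q} {C : V → KState Δ M Q}
    (h : AtStart i y C) (G : TVGraph E Δ) (t : ℕ) (u : V) (ℓ : Fin Δ)
    (hℓ : (G.peer t u ℓ).isSome) :
    ℓ ∈ ((C u).refresh (pull G t C u)).pending false := by
  rw [h.refresh_eq]
  obtain ⟨⟨v, m⟩, hp⟩ := Option.isSome_iff_exists.1 hℓ
  refine ⟨⟨hℓ, by simp⟩, h.block u ℓ, (C v).exposed m, by simp [pull, hp], ?_, ?_⟩
  · simp [KState.exposed, h.phase]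
  · simp [KState.exposed, h.ack]

theorem AtStart.next {i : ℕ} {y : V → AlgState Δ M Q} {C : V → KState Δ M Q}
    (h₀ : AtStart i y C) (G : TVGraph E Δ) (t : ℕ) (y' : V → AlgState Δ M Q) :
    Acknowledged (G.peer t) i y (nextConfig G t (fun _ => some .handshake) y' C) := by
  have h := h₀.detect G t
  constructor
  · constructor
    all_goals intro u
    all_goals
      simp only [nextConfig, localNext, KState.handshake, h.refresh_eq]
    · exact h.alg u
    · exact h.phase u
    · intro ℓ v m hp
      refine ⟨(KappaSync.detect G t C v).exposed m, by simp [pull, hp], ?_, ?_, ?_⟩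
      · exact h.phase v
      · simp [KState.exposed, h.alg]
      · simp [KState.exposed, h.alg]
  · intro u ℓ hℓ
    simp [nextConfig, localNext, KState.handshake, h.mem_pending_false G t u ℓ hℓ]

open Classical in
/-- The schedule of the second stage of a phase: a handshake wherever it is enabled. -/
noncomputable def handshakeIfEnabled (C : V → KState Δ M Q) (u : V) : Option KAction :=
  if (C u).guard .handshake then some .handshake else none

/-- The pull of the second handshake reads a raised `ack` at every connected port.  It leaves the rest of
the stored information alone, since all neighbours were last seen in the current phase. -/
theorem Acknowledged.refresh_eq {G : TVGraph E Δ} {t i : ℕ} {y : V → AlgState Δ M Q}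
    {C : V → KState Δ M Q} (h : Acknowledged (G.peer t) i y C) (u : V) :
    ∃ X', (C u).refresh (pull G t C u) = { C u with X := X' } ∧
      ∀ ℓ v m, G.peer t u ℓ = some (v, m) → ∃ z, X' ℓ = some z ∧ z.phase = i ∧
        z.main = (y v).main ∧ z.portState = (y v).ports m ∧ z.ack = true := by
  refine ⟨((C u).refresh (pull G t C u)).X, ?_, ?_⟩
  · simp only [KState.refresh, h.synch u, Bool.true_eq_false, if_false, h.Dt, h.D, Set.union_self]
  · intro ℓ v m hp
    obtain ⟨z, hz, hz1, hz2, hz3⟩ := h.X u ℓ v m hp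
    have hack : (C v).ack m = true := h.ack v m (by simp [G.peer_symm hp])
    refine ⟨{ z with ack := true }, ?_, hz1, hz2, hz3, rfl⟩
    simp [KState.refresh, h.synch u, h.Dt, h.D, h.P, hz, hz1, pull, hp, h.phase,
      KState.exposed, hack]

theorem Acknowledged.next {G : TVGraph E Δ} {t i : ℕ} {y : V → AlgState Δ M Q}
    {C : V → KState Δ M Q} (h : Acknowledged (G.peer t) i y C) (hlost : ∀ u, G.lost t u = ∅)
    (y' : V → AlgState Δ M Q) :
    Blocked (G.peer t) i y (nextConfig G t (handshakeIfEnabled C) y' C) := by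
  have key : ∀ u, ∃ L : KState Δ M Q,
      localNext (C u) (pull G t C u) (y' u) (handshakeIfEnabled C u) = L ∧
      L.alg = y u ∧ L.synch = true ∧ L.phase = i ∧ L.P = {ℓ | (G.peer t u ℓ).isSome} ∧
      L.Dt = ∅ ∧ L.D = ∅ ∧
      (∀ ℓ v m, G.peer t u ℓ = some (v, m) → ∃ z, L.X ℓ = some z ∧ z.phase = i ∧
        z.main = (y v).main ∧ z.portState = (y v).ports m) ∧
      ∀ ℓ, (G.peer t u ℓ).isSome → L.block ℓ = true := by
    intro u
    refine ⟨_, rfl, ?_⟩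
    by_cases hg : (C u).guard .handshake
    · obtain ⟨X', hX', hX⟩ := h.refresh_eq u
      simp only [handshakeIfEnabled, hg, if_true, localNext, KState.handshake, hX']
      refine ⟨h.alg u, h.synch u, h.phase u, h.P u, h.Dt u, trivial, ?_, ?_⟩
      · intro ℓ v m hp
        obtain ⟨z, hz, hz1, hz2, hz3, -⟩ := hX ℓ v m hp
        exact ⟨z, hz, hz1, hz2, hz3⟩
      · intro ℓ hℓ
        obtain ⟨⟨v, m⟩, hp⟩ := Option.isSome_iff_exists.1 hℓ
        obtain ⟨z, hz, hz1, -, -, hz4⟩ := hX ℓ v m hp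
        cases hb : (C u).block ℓ
        · rw [if_pos]
          rw [hX']
          refine ⟨⟨?_, ?_⟩, hb, z, hz, hz1.trans (h.phase u).symm, hz4⟩
          · exact (h.P u).symm ▸ hℓ
          · simp [h.Dt]
        · simp
    · simp only [handshakeIfEnabled, hg, if_false, localNext]
      refine ⟨h.alg u, h.synch u, h.phase u, h.P u, h.Dt u, h.D u, h.X u, fun ℓ hℓ => ?_⟩
      -- Without an enabled handshake all ports in `P` are blocked already.
      by_contra hb
      refine hg (Or.inr ⟨ℓ, ⟨?_, ?_⟩, by simpa using hb⟩)
      · exact (h.P u).symm ▸ hℓ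
      · simp [h.Dt]
  choose L hL h1 h2 h3 h4 h5 h6 h7 h8 using key
  -- The `block` flags written by neighbours are the only further change, and they only get set.
  have hnext : ∀ u, nextConfig G t (handshakeIfEnabled C) y' C u =
      { L u with block := (nextConfig G t (handshakeIfEnabled C) y' C u).block } := by
    intro u
    simp only [nextConfig, detect_eq_self hlost, hL]
  constructor
  · constructor
    all_goals intro u
    all_goals rw [hnext]
    exacts [h1 u, h2 u, h3 u, h4 u, h5 u, h6 u, h7 u]
  · intro u ℓ hℓ
    simp [nextConfig, detect_eq_self hlost, hL, h8 u ℓ hℓ]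

theorem Blocked.guard {peer : V → Fin Δ → Option (V × Fin Δ)} {i : ℕ} {y : V → AlgState Δ M Q}
    {C : V → KState Δ M Q} (h : Blocked peer i y C) (u : V) : (C u).guard .executeSynch := by
  refine ⟨h.synch u, fun ℓ hℓ => h.block u ℓ ?_⟩
  have := hℓ.1
  rwa [h.P] at this

theorem Blocked.view_eq {G : TVGraph E Δ} {i : ℕ} {y : V → AlgState Δ M Q}
    {C : V → KState Δ M Q} (h : Blocked (G.peer i) i y C) (u : V) :
    (C u).view = syncView G i y u := by
  funext ℓ
  simp only [KState.view, KState.final, syncView, h.P, Set.mem_ofPred_eq]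
  rcases hp : G.peer i u ℓ with _ | ⟨v, m⟩
  · simp
  · obtain ⟨z, hz, -, hz2, hz3⟩ := h.X u ℓ v m hp
    simp [h.block u ℓ (by simp [hp]), hz, hz2, hz3]

theorem Blocked.next {peer : V → Fin Δ → Option (V × Fin Δ)} {i : ℕ} {y : V → AlgState Δ M Q}
    {C : V → KState Δ M Q} (h : Blocked peer i y C) (G : TVGraph E Δ) (t : ℕ)
    (y' : V → AlgState Δ M Q) :
    AtStart (i + 1) y' (nextConfig G t (fun _ => some .executeSynch) y' C) := by
  constructor
  all_goals intro u
  all_goals simp [nextConfig, localNext, KState.execute, WritesBlock]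
  exact h.phase u

/-! ### The execution -/

/-- The schedule of stage `t`, which starts in configuration `C`. -/
noncomputable def lockstepAct (t : ℕ) (C : V → KState Δ M Q) : V → Option KAction :=
  if t % 3 = 0 then fun _ => some .handshake
  else if t % 3 = 1 then handshakeIfEnabled C
  else fun _ => some .executeSynch

/-- The configurations of the lockstep execution under `G` that replays the sequence `x`. -/
noncomputable def lockstep (G : TVGraph E Δ) (x : ℕ → V → AlgState Δ M Q) :
    ℕ → V → KState Δ M Q
  | 0 => fun u => KState.init (x 0 u)
  | t + 1 => nextConfig G t (lockstepAct t (lockstep G x t)) (x (t / 3 + 1)) (lockstep G x t)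

/-- The graph of the lockstep execution: every snapshot is held for three stages. -/
def TVGraph.tripled (G : TVGraph E Δ) : TVGraph E Δ :=
  G.slowDown (· / 3) fun t => by omega

theorem TVGraph.peer_tripled (G : TVGraph E Δ) (i k : ℕ) (hk : k < 3) :
    G.tripled.peer (3 * i + k) = G.peer i := by
  funext u ℓ
  rw [TVGraph.tripled, TVGraph.peer_slowDown]
  congr 1
  omega

theorem TVGraph.lost_tripled (G : TVGraph E Δ) (i k : ℕ) (hk : k < 2) (u : V) :
    G.tripled.lost (3 * i + k + 1) u = ∅ := by
  refine TVGraph.lost_eq_empty_of_snap_eq _ _ _ ?_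
  change G.snap ((3 * i + k) / 3) = G.snap ((3 * i + k + 1) / 3)
  congr 1
  omega

section Lockstep

variable (G : TVGraph E Δ) (x : ℕ → V → AlgState Δ M Q)

theorem lockstep_acknowledged {i : ℕ} (h : AtStart i (x i) (lockstep G.tripled x (3 * i))) :
    Acknowledged (G.peer i) i (x i) (lockstep G.tripled x (3 * i + 1)) := by
  have := h.next G.tripled (3 * i) (x (3 * i / 3 + 1))
  rw [← G.peer_tripled i 0 (by norm_num)]
  simpa [lockstep, lockstepAct] using this

theorem lockstep_blocked {i : ℕ}
    (h : Acknowledged (G.peer i) i (x i) (lockstep G.tripled x (3 * i + 1))) :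
    Blocked (G.peer i) i (x i) (lockstep G.tripled x (3 * i + 2)) := by
  rw [← G.peer_tripled i 1 (by norm_num)] at h ⊢
  have := h.next (G.lost_tripled i 0 (by norm_num)) (x ((3 * i + 1) / 3 + 1))
  have hm : (3 * i + 1) % 3 = 1 := by omega
  rw [lockstep, lockstepAct, if_neg (by omega), if_pos hm]
  exact this

theorem lockstep_atStart_succ {i : ℕ}
    (h : Blocked (G.peer i) i (x i) (lockstep G.tripled x (3 * i + 2))) :
    AtStart (i + 1) (x (i + 1)) (lockstep G.tripled x (3 * (i + 1))) := by
  have := h.next G.tripled (3 * i + 2) (x ((3 * i + 2) / 3 + 1))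
  rw [show 3 * (i + 1) = 3 * i + 2 + 1 by ring, lockstep, lockstepAct, if_neg (by omega),
    if_neg (by omega)]
  rwa [show (3 * i + 2) / 3 = i by omega] at this ⊢

theorem lockstep_atStart (i : ℕ) : AtStart i (x i) (lockstep G.tripled x (3 * i)) := by
  induction i with
  | zero => exact ⟨fun _ => rfl, fun _ => rfl, fun _ => rfl, fun _ _ => rfl, fun _ _ => rfl⟩
  | succ i ih =>
    exact lockstep_atStart_succ G x (lockstep_blocked G x (lockstep_acknowledged G x ih))

theorem lockstep_phase (t : ℕ) (u : V) : (lockstep G.tripled x t u).phase = t / 3 := by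
  have h0 := lockstep_atStart G x (t / 3)
  have h1 := lockstep_acknowledged G x h0
  have h2 := lockstep_blocked G x h1
  obtain h | h | h : t = 3 * (t / 3) ∨ t = 3 * (t / 3) + 1 ∨ t = 3 * (t / 3) + 2 := by omega
  · have := h0.phase u
    rwa [← h] at this
  · have := h1.phase u
    rwa [← h] at this
  · have := h2.phase u
    rwa [← h] at this

theorem lockstep_isStage {A : Alg Δ M Q Act} (hx : IsSyncExecution A G x) (t : ℕ) :
    IsStage A G.tripled t (lockstepAct t (lockstep G.tripled x t))
      (lockstep G.tripled x t) (lockstep G.tripled x (t + 1)) := by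
  have h0 := lockstep_atStart G x (t / 3)
  have h2 := lockstep_blocked G x (lockstep_acknowledged G x h0)
  rw [lockstep]
  apply isStage_nextConfig
  · intro u a ha
    obtain h | h | h : t % 3 = 0 ∨ t % 3 = 1 ∨ t % 3 = 2 := by omega
    · simp only [lockstepAct, h, if_true, Option.some.injEq] at ha
      subst ha
      rw [show 3 * (t / 3) = t by omega] at h0
      exact Or.inl (h0.synch u)
    · simp only [lockstepAct, h, one_ne_zero, if_true, if_false, handshakeIfEnabled,
        Option.ite_none_right_eq_some, Option.some.injEq] at ha
      obtain ⟨hg, rfl⟩ := ha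
      exact hg
    · simp only [lockstepAct, h, OfNat.ofNat_ne_zero, OfNat.ofNat_ne_one, if_false,
        Option.some.injEq] at ha
      subst ha
      rw [show 3 * (t / 3) + 2 = t by omega] at h2
      exact h2.guard u
  · intro u ha
    obtain h | h | h : t % 3 = 0 ∨ t % 3 = 1 ∨ t % 3 = 2 := by omega
    · simp [lockstepAct, h] at ha
    · simp [lockstepAct, h, handshakeIfEnabled] at ha
    · rw [show 3 * (t / 3) + 2 = t by omega] at h2
      have hrun := hx (t / 3) u
      rw [← h2.view_eq, ← h2.alg] at hrun
      exact hrun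

end Lockstep

end KappaSync

theorem mainTheorem1 {V : Type*} {E : SimpleGraph V} {Δ : ℕ} {M Q Act : Type*}
    (A : KappaSync.Alg Δ M Q Act) (Gsynch : KappaSync.TVGraph E Δ)
    (x : ℕ → V → KappaSync.AlgState Δ M Q) (hx : KappaSync.IsSyncExecution A Gsynch x) :
    ∃ (Gsemi : KappaSync.TVGraph E Δ) (act : ℕ → V → Option KappaSync.KAction)
      (C : ℕ → V → KappaSync.KState Δ M Q),
      KappaSync.IsSemiSyncExecution A Gsemi act C ∧
      KappaSync.WeaklyFair act C ∧
      (∀ u, (C 0 u).alg = x 0 u) ∧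
      ∀ i u, (∃ t, KappaSync.EndsPhase C u i t) ∧
        ∀ t, KappaSync.EndsPhase C u i t → (C (t + 1) u).alg = x (i + 1) u := by
  refine ⟨Gsynch.tripled,
    fun t => KappaSync.lockstepAct t (KappaSync.lockstep Gsynch.tripled x t),
    KappaSync.lockstep Gsynch.tripled x, ⟨fun u => ⟨x 0 u, rfl⟩,
    KappaSync.lockstep_isStage Gsynch x hx⟩, ?_, fun u => rfl, ?_⟩
  · -- Every node is active in all stages that are multiples of three.
    intro u t _
    exact ⟨3 * t, by omega, by simp [KappaSync.lockstepAct]⟩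
  · intro i u
    refine ⟨⟨3 * i + 2, ?_, ?_⟩, ?_⟩
    · rw [KappaSync.lockstep_phase]
      omega
    · rw [KappaSync.lockstep_phase]
      omega
    · rintro t ⟨h1, h2⟩
      rw [KappaSync.lockstep_phase] at h1 h2
      obtain rfl : t = 3 * i + 2 := by omega
      exact (KappaSync.lockstep_atStart Gsynch x (i + 1)).alg u
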